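/- Let $P$ be a probability measure on $\mathbb{R}^D$ whose support $M$ is compact (for instance a compact $d$-dimensional submanifold), and let $d\ge 0$ be an integer. For $x\in M$ and $t>0$ put $$\rho(x,t)=\frac{P(B(x,t/2))}{t^d},\qquad \rho(t)=\inf_{x\in M}\rho(x,t),$$ where $B(x,r)$ is the closed Euclidean ball of radius $r$ centred at $x$. Assume that there are $t_0>0$ and $C_1<\infty$ such that, for every $x\in M$, the function $t\mapsto\rho(x,t)$ is differentiable on $(0,t_0)$ with $|\partial\rho(x,t)/\partial t|\le C_1$, and that $\rho:=\lim_{t\downarrow 0}\rho(t)>0$. Let $X_1,X_2,\dots$ be i.i.d. with law $P$, let $\mathcal S_n=\{X_1,\dots,X_n\}$, let $\mathbf H$ be the Hausdorff distance, and let $b=b_n$ be integers with $b_n\ge 1$ for all large $n$ and $b_n=o(n/\log n)$. Let $\mathcal S^j_{b,n}$, $j=1,\dots,N=\binom nb$, be all the subsamples of $\mathcal S_n$ of size $b$ (chosen by index) and define $$L_b(t)=\frac1N\sum_{j=1}^N I\big(\mathbf H(\mathcal S^j_{b,n},\mathcal S_n)>t\big).$$ For $\alpha\in(0,1)$ let $$c_b=2L_b^{-1}(\alpha),\qquad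 L_b^{-1}(\alpha)=\inf\{t:\ L_b(t)\le\alpha\};$$ whenever the equation $L_b(c/2)=\alpha$ has a solution, $c_b$ is its least solution. Then there is a constant $C$ such that, for all large $n$, $$\mathbb P\big(\mathbf H(\mathcal S_n,M)>c_b\big)\le \alpha+C\Big(\frac bn\Big)^{1/4}.$$ -/

import Mathlib

open MeasureTheory ProbabilityTheory Filter Topology Asymptotics

noncomputable section

/-- The ratio `ρ(x,t) = P(B(x,t/2)) / t^d`; only its values at `t > 0` are used. -/
def ballRatio {D : ℕ} (P : Measure (EuclideanSpace ℝ (Fin D))) (d : ℕ)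
    (x : EuclideanSpace ℝ (Fin D)) (t : ℝ) : ℝ :=
  P.real (Metric.closedBall x (t / 2)) / t ^ d

/-- The lower envelope `ρ(t) = inf_{x ∈ M} ρ(x,t)`. -/
def infBallRatio {D : ℕ} (P : Measure (EuclideanSpace ℝ (Fin D)))
    (M : Set (EuclideanSpace ℝ (Fin D))) (d : ℕ) (t : ℝ) : ℝ :=
  ⨅ x : M, ballRatio P d (x : EuclideanSpace ℝ (Fin D)) t

open Classical in
/-- `L_b(t)`: the proportion, among all `n.choose b` subsamples of size `b` of the data
`x₁, …, xₙ`, of those whose Hausdorff distance to the full sample exceeds `t`. -/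
def subsampleTail {D n : ℕ} (b : ℕ) (x : Fin n → EuclideanSpace ℝ (Fin D)) (t : ℝ) : ℝ :=
  (((Finset.univ : Finset (Fin n)).powersetCard b).filter
      (fun s : Finset (Fin n) => t < Metric.hausdorffDist (x '' (s : Set (Fin n))) (Set.range x))).card
    / (n.choose b : ℝ)

/-- The subsampling radius `c_b = 2 L_b⁻¹(α)`. As `L_b` is a step function, `L_b⁻¹(α)` is the
generalized inverse `inf {t | L_b(t) ≤ α}`; see the two lemmas below. -/
def subsampleRadius {D n : ℕ} (α : ℝ) (b : ℕ) (x : Fin n → EuclideanSpace ℝ (Fin D)) : ℝ :=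
  2 * sInf {t : ℝ | subsampleTail b x t ≤ α}

/-- `c_b / 2` is the least `t` with `L_b(t) ≤ α`. -/
theorem isLeast_subsampleRadius {D n : ℕ} {α : ℝ} (h0 : 0 ≤ α) (h1 : α < 1) {b : ℕ} (hb : b ≤ n)
    (x : Fin n → EuclideanSpace ℝ (Fin D)) :
    IsLeast {t : ℝ | subsampleTail b x t ≤ α} (subsampleRadius α b x / 2) := by
  classical
  have hN : (0 : ℝ) < n.choose b := by exact_mod_cast Nat.choose_pos hb
  have hlow : (0 : ℝ) ∈ lowerBounds {t : ℝ | subsampleTail b x t ≤ α} := by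
    intro t ht
    by_contra! hneg
    have hone : subsampleTail b x t = 1 := by
      unfold subsampleTail
      rw [Finset.filter_true_of_mem
        (fun s _ => hneg.trans_le Metric.hausdorffDist_nonneg), Finset.card_powersetCard]
      simp [hN.ne']
    have : subsampleTail b x t ≤ α := ht
    linarith
  have hne : {t : ℝ | subsampleTail b x t ≤ α}.Nonempty := by
    refine ⟨∑ s : Finset (Fin n),
      Metric.hausdorffDist (x '' (s : Set (Fin n))) (Set.range x), ?_⟩
    have hz : subsampleTail b x (∑ s : Finset (Fin n),
        Metric.hausdorffDist (x '' (s : Set (Fin n))) (Set.range x)) = 0 := by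
      unfold subsampleTail
      rw [Finset.filter_false_of_mem]
      · simp
      · intro s _
        exact not_lt.mpr (Finset.single_le_sum
          (f := fun s : Finset (Fin n) =>
            Metric.hausdorffDist (x '' (s : Set (Fin n))) (Set.range x))
          (fun _ _ => Metric.hausdorffDist_nonneg) (Finset.mem_univ s))
    simpa [hz] using h0
  have hcl : IsClosed {t : ℝ | subsampleTail b x t ≤ α} := by
    rw [← isOpen_compl_iff, isOpen_iff_mem_nhds]
    intro t ht
    have ht' : α < subsampleTail b x t := not_le.mp ht
    have hev : ∀ᶠ u in 𝓝 t, ∀ s : Finset (Fin n),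
        t < Metric.hausdorffDist (x '' (s : Set (Fin n))) (Set.range x) →
        u < Metric.hausdorffDist (x '' (s : Set (Fin n))) (Set.range x) := by
      rw [eventually_all]
      intro s
      by_cases hs : t < Metric.hausdorffDist (x '' (s : Set (Fin n))) (Set.range x)
      · filter_upwards [Iio_mem_nhds hs] with u hu _ using hu
      · exact Eventually.of_forall fun u h => absurd h hs
    filter_upwards [hev] with u hu
    refine not_le.mpr (ht'.trans_le ?_)
    unfold subsampleTail
    exact div_le_div_of_nonneg_right (by
      exact_mod_cast Finset.card_le_card
        (Finset.monotone_filter_right _ fun s _ hs => hu s hs)) hN.le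
  have heq : subsampleRadius α b x / 2 = sInf {t : ℝ | subsampleTail b x t ≤ α} := by
    unfold subsampleRadius; ring
  rw [heq]
  exact ⟨hcl.csInf_mem hne ⟨0, hlow⟩, fun t ht => csInf_le ⟨0, hlow⟩ ht⟩

/-- If `L_b(c/2) = α` has a solution, then `subsampleRadius` is its least solution. -/
theorem isLeast_subsampleRadius_eq {D n : ℕ} {α : ℝ} (h0 : 0 ≤ α) (h1 : α < 1) {b : ℕ}
    (hb : b ≤ n) (x : Fin n → EuclideanSpace ℝ (Fin D))
    (hsol : ∃ c : ℝ, subsampleTail b x (c / 2) = α) :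
    IsLeast {c : ℝ | subsampleTail b x (c / 2) = α} (subsampleRadius α b x) := by
  classical
  have hL := isLeast_subsampleRadius h0 h1 hb x
  have hlow : ∀ c : ℝ, subsampleTail b x (c / 2) = α → subsampleRadius α b x ≤ c := by
    intro c hc
    have := hL.2 (show c / 2 ∈ {t : ℝ | subsampleTail b x t ≤ α} from hc.le)
    linarith
  refine ⟨le_antisymm hL.1 ?_, hlow⟩
  obtain ⟨c, hc⟩ := hsol
  have hle := hlow c hc
  have hle' : subsampleRadius α b x / 2 ≤ c / 2 := by linarith
  calc α = subsampleTail b x (c / 2) := hc.symm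
    _ ≤ subsampleTail b x (subsampleRadius α b x / 2) := by
      unfold subsampleTail
      gcongr

end

/-! The error probability tends to zero, so it eventually falls below `α` and `C = 0` suffices. For
`d > 0`, balls of radius of order `t` centred in `M` have mass of order `t ^ d`: the lower bound
comes from `ρ > 0`, the upper one from the bounded derivative. The lower bound and a union bound
over a finite net make the sample `t`-dense in `M`, with `t ^ d` of order `log n / n`, outside an
event of probability `O(1 / n)` (`eventually_measureReal_coveringScale_lt_le`). If a subsample of
size `b` were `t`-close to such a sample, `b` balls of radius `3t` would cover `M`; their total mass
is `O(b log n / n)`, which tends to zero. So every subsample is farther than `t`, `L_b(t) = 1 > α`,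
and `c_b > 2t` exceeds the Hausdorff error (`lt_hausdorffDist_image_range`, `lt_subsampleRadius`).
For `d = 0` all points of `M` are atoms of mass bounded below; the sample exhausts them outside an
exponentially small event, and `c_b ≥ 0` is enough. -/

/-! ### Nets from lower bounds on ball masses. -/

section Covering

variable {E : Type*} [MetricSpace E] [MeasurableSpace E] [BorelSpace E]

/-- If every closed ball of radius `r` centred in `M` has mass at least `p`, then `M` has a finite
`2r`-net contained in `M` with at most `1 / p` points. -/
theorem exists_finset_net_of_le_measure_closedBall (P : Measure E) [IsProbabilityMeasure P]
    {M : Set E} {r p : ℝ} (hp : 0 < p) (hr : 0 ≤ r)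
    (hball : ∀ x ∈ M, p ≤ P.real (Metric.closedBall x r)) :
    ∃ N : Finset E, ↑N ⊆ M ∧ (∀ x ∈ M, ∃ y ∈ N, dist x y ≤ 2 * r) ∧ (N.card : ℝ) ≤ 1 / p := by
  classical
  -- Balls of radius `r` about `2r`-separated points are disjoint, so their masses bound the
  -- cardinality; a separated set of maximal size is a net.
  let S : Set ℕ := {k | ∃ N : Finset E, ↑N ⊆ M ∧
    (N : Set E).Pairwise (fun x y => 2 * r < dist x y) ∧ N.card = k}
  have hcard : ∀ N : Finset E, ↑N ⊆ M →
      (N : Set E).Pairwise (fun x y => 2 * r < dist x y) → (N.card : ℝ) ≤ 1 / p := by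
    intro N hNM hN
    have hdisj : (N : Set E).PairwiseDisjoint (fun x => Metric.closedBall x r) := by
      intro x hx y hy hxy
      exact Metric.closedBall_disjoint_closedBall (by linarith [hN hx hy hxy])
    have h1 := measureReal_biUnion_finset (μ := P) hdisj
      (fun _ _ => Metric.isClosed_closedBall.measurableSet)
    have h2 : (N.card : ℝ) * p ≤ ∑ x ∈ N, P.real (Metric.closedBall x r) := by
      rw [← nsmul_eq_mul]
      exact Finset.card_nsmul_le_sum _ _ _ fun x hx => hball x (hNM hx)
    rw [le_div_iff₀ hp]
    exact h2.trans (h1 ▸ measureReal_le_one)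
  have hbdd : BddAbove S := by
    refine ⟨⌊1 / p⌋₊, ?_⟩
    rintro _ ⟨N, h1, h2, rfl⟩
    exact Nat.le_floor (hcard N h1 h2)
  have hne : S.Nonempty := ⟨0, ∅, by simp, by simp, rfl⟩
  obtain ⟨N, hNM, hN, hNk⟩ := Nat.sSup_mem hne hbdd
  refine ⟨N, hNM, ?_, hcard N hNM hN⟩
  intro x hx
  by_contra! hfar
  have hxN : x ∉ N := fun h => by
    have := hfar x h
    rw [dist_self] at this
    linarith
  have hmem : N.card + 1 ∈ S := by
    refine ⟨insert x N, ?_, ?_, Finset.card_insert_of_notMem hxN⟩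
    · rw [Finset.coe_insert]
      exact Set.insert_subset hx hNM
    · rw [Finset.coe_insert]
      refine hN.insert fun y hy _ => ⟨hfar y hy, ?_⟩
      rw [dist_comm]
      exact hfar y hy
  have := le_csSup hbdd hmem
  omega

end Covering

/-- The probability that `n` independent draws from `P` all miss a set of mass at least `q`. -/
theorem measureReal_forall_notMem_le {E Ω : Type*} [MeasurableSpace E] [MeasurableSpace Ω]
    {μ : Measure Ω} [IsProbabilityMeasure μ]
    {P : Measure E} [IsProbabilityMeasure P] {X : ℕ → Ω → E} (hX : iIndepFun X μ)
    (hlaw : ∀ i, HasLaw (X i) P μ) {B : Set E} (hB : MeasurableSet B) {q : ℝ}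
    (hq : q ≤ P.real B) (n : ℕ) :
    μ.real {ω | ∀ i : Fin n, X i ω ∉ B} ≤ Real.exp (-(n * q)) := by
  have hset : {ω | ∀ i : Fin n, X i ω ∉ B} = ⋂ i ∈ Finset.range n, X i ⁻¹' Bᶜ := by
    ext ω
    simp [Fin.forall_iff]
  have hone : ∀ i, (μ (X i ⁻¹' Bᶜ)).toReal ≤ Real.exp (-q) := by
    intro i
    have h1 : μ.real (X i ⁻¹' Bᶜ) = P.real Bᶜ :=
      (hlaw i).measureReal_eq (p := fun x => x ∈ Bᶜ) hB.compl
    rw [← measureReal_def, h1, probReal_compl_eq_one_sub hB]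
    linarith [Real.add_one_le_exp (-q)]
  rw [hset, measureReal_def, hX.measure_inter_preimage_eq_mul _ (fun _ _ => hB.compl),
    ENNReal.toReal_prod]
  refine (Finset.prod_le_prod (fun _ _ => ENNReal.toReal_nonneg) fun i _ => hone i).trans ?_
  rw [Finset.prod_const, Finset.card_range, ← Real.exp_nat_mul]
  simp

/-! ### Density of samples and coarseness of subsamples. -/

section Sampling

variable {E Ω : Type*} [MetricSpace E] [MeasurableSpace E] [MeasurableSpace Ω]

/-- A tail bound for the Hausdorff distance between a sample and the set it is drawn from. -/
theorem measureReal_lt_hausdorffDist_range_le [BorelSpace E] {μ : Measure Ω} [IsProbabilityMeasure μ]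
    {P : Measure E} [IsProbabilityMeasure P] {X : ℕ → Ω → E} (hX : iIndepFun X μ)
    (hlaw : ∀ i, HasLaw (X i) P μ) {M : Set E} (hXM : ∀ᵐ ω ∂μ, ∀ i, X i ω ∈ M)
    {t p q : ℝ} (ht : 0 ≤ t) (hp : 0 < p)
    (hpball : ∀ x ∈ M, p ≤ P.real (Metric.closedBall x (t / 4)))
    (hqball : ∀ x ∈ M, q ≤ P.real (Metric.closedBall x (t / 2))) (n : ℕ) :
    μ.real {ω | t < Metric.hausdorffDist (Set.range fun i : Fin n => X i ω) M}
      ≤ 1 / p * Real.exp (-(n * q)) := by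
  obtain ⟨N, hNM, hcov, hcard⟩ :=
    exists_finset_net_of_le_measure_closedBall P hp (by linarith : 0 ≤ t / 4) hpball
  -- The net has mesh `2 * (t / 4) = t / 2`; a sample point within `t / 2` of each net point is then
  -- within `t` of all of `M`.
  have hle : {ω | t < Metric.hausdorffDist (Set.range fun i : Fin n => X i ω) M} ≤ᵐ[μ]
      ⋃ y ∈ N, {ω | ∀ i : Fin n, X i ω ∉ Metric.closedBall y (t / 2)} := by
    filter_upwards [hXM] with ω hω hlt
    by_contra hnot
    have hhit : ∀ y ∈ N, ∃ i : Fin n, dist (X i ω) y ≤ t / 2 := by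
      intro y hy
      by_contra! h
      exact hnot (Set.mem_biUnion (Finset.mem_coe.2 hy) fun i hi => (h i).not_ge hi)
    have hlt' : t < Metric.hausdorffDist (Set.range fun i : Fin n => X i ω) M := hlt
    refine hlt'.not_ge (Metric.hausdorffDist_le_of_mem_dist ht ?_ ?_)
    · rintro _ ⟨i, rfl⟩
      exact ⟨X i ω, hω i, by simpa using ht⟩
    · intro x hx
      obtain ⟨y, hy, hxy⟩ := hcov x hx
      obtain ⟨i, hi⟩ := hhit y hy
      refine ⟨_, ⟨i, rfl⟩, ?_⟩
      have := dist_triangle_right x (X i ω) y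
      linarith
  calc μ.real {ω | t < Metric.hausdorffDist (Set.range fun i : Fin n => X i ω) M}
      ≤ μ.real (⋃ y ∈ N, {ω | ∀ i : Fin n, X i ω ∉ Metric.closedBall y (t / 2)}) :=
        ENNReal.toReal_mono (measure_ne_top _ _) (measure_mono_ae hle)
    _ ≤ ∑ y ∈ N, μ.real {ω | ∀ i : Fin n, X i ω ∉ Metric.closedBall y (t / 2)} :=
        measureReal_biUnion_finset_le _ _
    _ ≤ ∑ _y ∈ N, Real.exp (-(n * q)) := Finset.sum_le_sum fun y hy =>
        measureReal_forall_notMem_le hX hlaw Metric.isClosed_closedBall.measurableSet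
          (hqball y (hNM hy)) n
    _ = N.card * Real.exp (-(n * q)) := by simp
    _ ≤ 1 / p * Real.exp (-(n * q)) := by gcongr

/-- A subsample of `b` points does not come `t`-close to the sample if the sample is `t`-close to a
set of full measure on which no `b` balls of radius `3t` exhaust the mass. -/
theorem lt_hausdorffDist_image_range {P : Measure E} [IsProbabilityMeasure P] {M : Set E}
    (hM : Bornology.IsBounded M) (hPM : P.real M = 1) {n : ℕ} {x : Fin n → E}
    (hx : ∀ i, x i ∈ M) {t κ : ℝ} (ht : 0 < t)
    (hxM : Metric.hausdorffDist (Set.range x) M ≤ t)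
    (hball : ∀ y ∈ M, P.real (Metric.closedBall y (3 * t)) ≤ κ)
    {s : Finset (Fin n)} (hs : s.Nonempty) (hκ : s.card * κ < 1) :
    t < Metric.hausdorffDist (x '' (s : Set (Fin n))) (Set.range x) := by
  by_contra! hle
  obtain ⟨i₀, hi₀⟩ := hs
  have hbr : Bornology.IsBounded (Set.range x) := hM.subset (Set.range_subset_iff.2 hx)
  have hbi : Bornology.IsBounded (x '' (s : Set (Fin n))) := hbr.subset (Set.image_subset_range _ _)
  have hrne : (Set.range x).Nonempty := ⟨_, i₀, rfl⟩
  -- An infinite extended distance would make `hausdorffDist` zero by default, and a bound on it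
  -- would carry no information.
  have hfin1 : Metric.hausdorffEDist (Set.range x) M ≠ ⊤ :=
    Metric.hausdorffEDist_ne_top_of_nonempty_of_bounded hrne ⟨_, hx i₀⟩ hbr hM
  have hfin2 : Metric.hausdorffEDist (x '' (s : Set (Fin n))) (Set.range x) ≠ ⊤ :=
    Metric.hausdorffEDist_ne_top_of_nonempty_of_bounded ⟨_, i₀, hi₀, rfl⟩ hrne hbi hbr
  have hcov : M ⊆ ⋃ i ∈ s, Metric.closedBall (x i) (3 * t) := by
    intro m hm
    -- Nearby points exist only within distances strictly above the Hausdorff distance; two hops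
    -- shorter than `3 / 2 * t` give the radius `3 * t`.
    obtain ⟨_, ⟨i, rfl⟩, hi⟩ := Metric.exists_dist_lt_of_hausdorffDist_lt' hm
      (hxM.trans_lt (by linarith : t < 3 / 2 * t)) hfin1
    obtain ⟨_, ⟨j, hj, rfl⟩, hji⟩ := Metric.exists_dist_lt_of_hausdorffDist_lt'
      (Set.mem_range_self i) (hle.trans_lt (by linarith : t < 3 / 2 * t)) hfin2
    refine Set.mem_biUnion hj ?_
    rw [Metric.mem_closedBall, dist_comm]
    linarith [dist_triangle (x j) (x i) m]
  have : (1 : ℝ) ≤ s.card * κ := by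
    calc (1 : ℝ) = P.real M := hPM.symm
      _ ≤ P.real (⋃ i ∈ s, Metric.closedBall (x i) (3 * t)) :=
        measureReal_mono hcov (measure_ne_top _ _)
      _ ≤ ∑ i ∈ s, P.real (Metric.closedBall (x i) (3 * t)) := measureReal_biUnion_finset_le _ _
      _ ≤ ∑ _i ∈ s, κ := Finset.sum_le_sum fun i _ => hball _ (hx i)
      _ = s.card * κ := by simp
  linarith

end Sampling

/-! ### Lower bounds for the subsampling radius. -/

section Radius

variable {D n : ℕ} {α : ℝ} {b : ℕ}

/-- At every level up to `t` the tail equals `1 > α`. The inequality is strict because the infimum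
is attained. -/
theorem lt_subsampleRadius (h0 : 0 ≤ α) (h1 : α < 1) (hb : b ≤ n)
    (x : Fin n → EuclideanSpace ℝ (Fin D)) {t : ℝ}
    (h : ∀ s : Finset (Fin n), s.card = b →
      t < Metric.hausdorffDist (x '' (s : Set (Fin n))) (Set.range x)) :
    2 * t < subsampleRadius α b x := by
  by_contra! hle
  have hmem : subsampleTail b x (subsampleRadius α b x / 2) ≤ α :=
    (isLeast_subsampleRadius h0 h1 hb x).1
  have hN : (0 : ℝ) < n.choose b := by exact_mod_cast Nat.choose_pos hb
  have hone : subsampleTail b x (subsampleRadius α b x / 2) = 1 := by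
    unfold subsampleTail
    rw [Finset.filter_true_of_mem, Finset.card_powersetCard]
    · simp [hN.ne']
    · intro s hs
      have := h s (Finset.mem_powersetCard.1 hs).2
      linarith
  linarith

theorem subsampleRadius_nonneg (h0 : 0 ≤ α) (h1 : α < 1) (hb : b ≤ n)
    (x : Fin n → EuclideanSpace ℝ (Fin D)) : 0 ≤ subsampleRadius α b x := by
  by_contra! hneg
  have := lt_subsampleRadius h0 h1 hb x (t := subsampleRadius α b x / 2) fun s _ =>
    (by linarith : subsampleRadius α b x / 2 < 0).trans_le Metric.hausdorffDist_nonneg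
  linarith

end Radius

/-! ### Two-sided bounds on ball masses. -/

section BallMass

variable {D d : ℕ} {P : Measure (EuclideanSpace ℝ (Fin D))} {M : Set (EuclideanSpace ℝ (Fin D))}

theorem ballRatio_nonneg (x : EuclideanSpace ℝ (Fin D)) {t : ℝ} (ht : 0 ≤ t) :
    0 ≤ ballRatio P d x t :=
  div_nonneg measureReal_nonneg (pow_nonneg ht d)

theorem ballRatio_mul_pow (x : EuclideanSpace ℝ (Fin D)) {t : ℝ} (ht : 0 < t) :
    ballRatio P d x t * t ^ d = P.real (Metric.closedBall x (t / 2)) :=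
  div_mul_cancel₀ _ (pow_pos ht d).ne'

/-- If the lower envelope stays above a positive level near `0`, small balls have mass at least of
order `t ^ d`. -/
theorem exists_forall_mul_pow_le_measureReal_closedBall {ρ : ℝ}
    (hρ : Tendsto (infBallRatio P M d) (𝓝[>] 0) (𝓝 ρ)) (hρ_pos : 0 < ρ) :
    ∃ r > 0, ∀ t, 0 < t → t < r → ∀ x ∈ M,
      ρ / 2 * t ^ d ≤ P.real (Metric.closedBall x (t / 2)) := by
  have hev : ∀ᶠ t in 𝓝[>] (0 : ℝ), ρ / 2 < infBallRatio P M d t :=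
    hρ.eventually_const_lt (by linarith)
  obtain ⟨r, hr, hsub⟩ := mem_nhdsGT_iff_exists_Ioo_subset.1 hev
  refine ⟨r, hr, fun t ht htr x hx => ?_⟩
  have h1 : ρ / 2 < infBallRatio P M d t := hsub ⟨ht, htr⟩
  have h2 : infBallRatio P M d t ≤ ballRatio P d x t :=
    ciInf_le (f := fun y : M => ballRatio P d (y : EuclideanSpace ℝ (Fin D)) t)
      ⟨0, by rintro _ ⟨y, rfl⟩; exact ballRatio_nonneg _ ht.le⟩ ⟨x, hx⟩
  rw [← ballRatio_mul_pow x ht]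
  gcongr
  exact (h1.trans_le h2).le

/-- If the density ratio has a uniformly bounded derivative, small balls have mass at most of order
`t ^ d`. -/
theorem exists_forall_measureReal_closedBall_le_mul_pow [IsProbabilityMeasure P] {t₀ C₁ : ℝ}
    (ht₀ : 0 < t₀)
    (hdiff : ∀ x ∈ M, ∀ t ∈ Set.Ioo 0 t₀,
      DifferentiableAt ℝ (ballRatio P d x) t ∧ |deriv (ballRatio P d x) t| ≤ C₁) :
    ∃ K, 0 < K ∧ ∀ t, 0 < t → t < t₀ → ∀ x ∈ M,
      P.real (Metric.closedBall x (t / 2)) ≤ K * t ^ d := by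
  -- The first term bounds the ratio at the reference point `t₀ / 2`, the second its variation over
  -- `(0, t₀)` by the mean value inequality.
  refine ⟨1 / (t₀ / 2) ^ d + |C₁| * t₀, by positivity, fun t ht htt x hx => ?_⟩
  have hmid : t₀ / 2 ∈ Set.Ioo 0 t₀ := ⟨by linarith, by linarith⟩
  have hmv := (convex_Ioo 0 t₀).norm_image_sub_le_of_norm_deriv_le
    (fun u hu => (hdiff x hx u hu).1) (fun u hu => (hdiff x hx u hu).2) hmid ⟨ht, htt⟩
  have hdist : |t - t₀ / 2| ≤ t₀ := abs_le.2 ⟨by linarith, by linarith⟩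
  rw [Real.norm_eq_abs, Real.norm_eq_abs] at hmv
  have h1 : ballRatio P d x t - ballRatio P d x (t₀ / 2) ≤ |C₁| * t₀ :=
    (le_abs_self _).trans (hmv.trans (by gcongr; exact le_abs_self _))
  have h2 : ballRatio P d x (t₀ / 2) ≤ 1 / (t₀ / 2) ^ d := by
    unfold ballRatio
    gcongr
    exact measureReal_le_one
  rw [← ballRatio_mul_pow x ht]
  gcongr
  linarith

end BallMass

/-! ### Covering rates and comparison with the subsampling radius. -/

section Coverage

variable {D d : ℕ} {Ω : Type*} [MeasurableSpace Ω] {μ : Measure Ω}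
  {P : Measure (EuclideanSpace ℝ (Fin D))}
  {M : Set (EuclideanSpace ℝ (Fin D))} {X : ℕ → Ω → EuclideanSpace ℝ (Fin D)}

theorem ae_forall_mem_of_support_eq (hPM : P.support = M) (hM : IsClosed M)
    (hlaw : ∀ i, HasLaw (X i) P μ) : ∀ᵐ ω ∂μ, ∀ i, X i ω ∈ M := by
  rw [ae_all_iff]
  intro i
  rw [(hlaw i).ae_iff (p := fun x => x ∈ M) hM.measurableSet.mem, ← hPM]
  exact Measure.support_mem_ae

variable [IsProbabilityMeasure μ] [IsProbabilityMeasure P]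

theorem eventually_le_of_isLittleO_div_log {b : ℕ → ℕ}
    (hb : (fun n : ℕ => (b n : ℝ)) =o[atTop] fun n : ℕ => (n : ℝ) / Real.log n) :
    ∀ᶠ n in atTop, b n ≤ n := by
  filter_upwards [hb.bound one_pos, eventually_ge_atTop 3] with n hn hn3
  have hlog : 1 ≤ Real.log n := by
    rw [Real.le_log_iff_exp_le (by positivity)]
    have : (3 : ℝ) ≤ n := by exact_mod_cast hn3
    linarith [Real.exp_one_lt_d9]
  have hn' : (b n : ℝ) ≤ n / Real.log n := by
    simpa [abs_of_nonneg (zero_le_one.trans hlog)] using hn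
  exact_mod_cast hn'.trans (div_le_self (by positivity) hlog)

theorem tendsto_mul_log_div_of_isLittleO {b : ℕ → ℕ}
    (hb : (fun n : ℕ => (b n : ℝ)) =o[atTop] fun n : ℕ => (n : ℝ) / Real.log n) :
    Tendsto (fun n : ℕ => (b n : ℝ) * (Real.log n / n)) atTop (𝓝 0) := by
  simpa [div_eq_mul_inv, mul_comm] using hb.tendsto_div_nhds_zero

theorem tendsto_log_div_nat_atTop : Tendsto (fun n : ℕ => Real.log n / n) atTop (𝓝 0) := by
  have h := Real.isLittleO_log_id_atTop.tendsto_div_nhds_zero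
  exact h.comp tendsto_natCast_atTop_atTop

/-- In dimension zero the support consists of atoms, and the sample exhausts it with probability
tending to one. -/
theorem measureReal_zero_lt_hausdorffDist_le (hX_indep : iIndepFun X μ)
    (hlaw : ∀ i, HasLaw (X i) P μ) (hXM : ∀ᵐ ω ∂μ, ∀ i, X i ω ∈ M)
    {p r : ℝ} (hp : 0 < p) (hr : 0 < r)
    (hball : ∀ t, 0 < t → t < r → ∀ x ∈ M, p ≤ P.real (Metric.closedBall x (t / 2))) (n : ℕ) :
    μ.real {ω | 0 < Metric.hausdorffDist (Set.range fun i : Fin n => X i ω) M}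
      ≤ 1 / p * Real.exp (-(n * p)) := by
  -- Mass bounds hold only at positive scales below `r`, so level zero is reached by continuity from
  -- below; the shift by `2` keeps `u 0 < r`.
  let u : ℕ → ℝ := fun k => r / (k + 2)
  have hu_pos : ∀ k, 0 < u k := fun k => by positivity
  have hu_lt : ∀ k, u k < r := fun k =>
    div_lt_self hr (by have : (0 : ℝ) ≤ k := k.cast_nonneg; linarith)
  have hu_lim : Tendsto u atTop (𝓝 0) :=
    Tendsto.const_div_atTop (tendsto_atTop_add_const_right _ _ tendsto_natCast_atTop_atTop) _
  have hu_anti : Antitone u := fun k l hkl => by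
    have : (k : ℝ) ≤ l := by exact_mod_cast hkl
    change r / _ ≤ r / _
    gcongr
  let A : ℕ → Set Ω := fun k =>
    {ω | u k < Metric.hausdorffDist (Set.range fun i : Fin n => X i ω) M}
  have hA_mono : Monotone A := fun k l hkl ω hω => (hu_anti hkl).trans_lt hω
  have hA_union : {ω | 0 < Metric.hausdorffDist (Set.range fun i : Fin n => X i ω) M} =
      ⋃ k, A k := by
    ext ω
    rw [Set.mem_iUnion]
    exact ⟨fun h => (hu_lim.eventually_lt_const h).exists, fun ⟨k, hk⟩ => (hu_pos k).trans hk⟩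
  have hlim := (ENNReal.tendsto_toReal (measure_ne_top μ _)).comp
    (tendsto_measure_iUnion_atTop (μ := μ) hA_mono)
  rw [hA_union]
  refine le_of_tendsto' hlim fun k => ?_
  refine measureReal_lt_hausdorffDist_range_le hX_indep hlaw hXM (hu_pos k).le hp ?_
    (hball _ (hu_pos k) (hu_lt k)) n
  intro x hx
  have := hball (u k / 2) (half_pos (hu_pos k)) (by linarith [hu_pos k, hu_lt k]) x hx
  rwa [div_div, show (2 : ℝ) * 2 = 4 by norm_num] at this

/-- The scale `(A log n / n) ^ (1 / d)` at which a sample of size `n` covers a `d`-dimensional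
set. -/
noncomputable def coveringScale (d : ℕ) (A : ℝ) (n : ℕ) : ℝ :=
  (A * (Real.log n / n)) ^ (1 / d : ℝ)

theorem coveringScale_pow (hd : d ≠ 0) {A : ℝ} (hA : 0 ≤ A) (n : ℕ) :
    coveringScale d A n ^ d = A * (Real.log n / n) := by
  have : 0 ≤ A * (Real.log n / n) :=
    mul_nonneg hA (div_nonneg (Real.log_natCast_nonneg n) n.cast_nonneg)
  rw [coveringScale, one_div, Real.rpow_inv_natCast_pow this hd]

theorem coveringScale_pos {A : ℝ} (hA : 0 < A) {n : ℕ} (hn : 2 ≤ n) :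
    0 < coveringScale d A n := by
  have h1 : (1 : ℝ) < n := by exact_mod_cast hn
  have : 0 < Real.log n := Real.log_pos h1
  exact Real.rpow_pos_of_pos (by positivity) _

theorem tendsto_coveringScale (hd : d ≠ 0) (A : ℝ) :
    Tendsto (coveringScale d A) atTop (𝓝 0) := by
  have hd' : (0 : ℝ) < 1 / d := by positivity
  have h := (tendsto_log_div_nat_atTop.const_mul A).rpow_const (p := 1 / d) (Or.inr hd'.le)
  rwa [mul_zero, Real.zero_rpow hd'.ne'] at h

/-- In positive dimension the sample is `coveringScale`-dense in the support, up to probability of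
order `1 / n`. -/
theorem eventually_measureReal_coveringScale_lt_le (hd : d ≠ 0) (hX_indep : iIndepFun X μ)
    (hlaw : ∀ i, HasLaw (X i) P μ) (hXM : ∀ᵐ ω ∂μ, ∀ i, X i ω ∈ M)
    {c r : ℝ} (hc : 0 < c) (hr : 0 < r)
    (hball : ∀ t, 0 < t → t < r → ∀ x ∈ M, c * t ^ d ≤ P.real (Metric.closedBall x (t / 2))) :
    ∀ᶠ n : ℕ in atTop,
      μ.real {ω | coveringScale d (2 / c) n <
          Metric.hausdorffDist (Set.range fun i : Fin n => X i ω) M} ≤ 2 ^ d / n := by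
  -- The constant `2 / c` makes the exponential factor `n⁻²`, which beats the net size `2 ^ d * n /
  -- (2 * log n)`; `n ≥ 3` gives `log n ≥ 1`.
  filter_upwards [(tendsto_coveringScale hd (2 / c)).eventually_lt_const hr,
    eventually_ge_atTop 3] with n htr hn
  have htpos : 0 < coveringScale d (2 / c) n := coveringScale_pos (by positivity) (by omega)
  have htd := coveringScale_pow hd (by positivity : 0 ≤ 2 / c) n
  set t := coveringScale d (2 / c) n
  have hn3 : (3 : ℝ) ≤ n := by exact_mod_cast hn
  have hlog : 1 ≤ Real.log n := by
    rw [Real.le_log_iff_exp_le (by positivity)]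
    linarith [Real.exp_one_lt_d9]
  have hlog0 : 0 < Real.log n := by linarith
  have hn0 : (0 : ℝ) < n := by linarith
  have hp : c * (t / 2) ^ d = 2 * (Real.log n / n) / 2 ^ d := by
    rw [div_pow, htd]
    field_simp
  have hq : n * (c * t ^ d) = 2 * Real.log n := by
    rw [htd]
    field_simp
  have hmain := measureReal_lt_hausdorffDist_range_le hX_indep hlaw hXM htpos.le
    (p := c * (t / 2) ^ d) (q := c * t ^ d) (by positivity)
    (fun x hx => by
      have := hball (t / 2) (half_pos htpos) (by linarith) x hx
      rwa [div_div, show (2 : ℝ) * 2 = 4 by norm_num] at this)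
    (hball t htpos htr) n
  refine hmain.trans ?_
  have hexp : Real.exp (-(2 * Real.log n)) = 1 / (n : ℝ) ^ 2 := by
    rw [Real.exp_neg, two_mul, Real.exp_add, Real.exp_log hn0, one_div, sq]
  rw [hq, hp, hexp]
  calc 1 / (2 * (Real.log n / n) / 2 ^ d) * (1 / (n : ℝ) ^ 2)
      = 2 ^ d / n / (2 * Real.log n) := by field_simp
    _ ≤ 2 ^ d / n := div_le_self (by positivity) (by linarith)

/-- As `b = o(n / log n)`, subsamples of size `b` are much coarser than the scale at which the
sample covers the support, so that the subsampling radius dominates the Hausdorff error. -/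
theorem eventually_two_mul_coveringScale_lt_subsampleRadius (hd : d ≠ 0) (hM : IsCompact M)
    (hPM : P.real M = 1) {K t₀ A : ℝ} (ht₀ : 0 < t₀) (hA : 0 < A)
    (hball : ∀ t, 0 < t → t < t₀ → ∀ x ∈ M, P.real (Metric.closedBall x (t / 2)) ≤ K * t ^ d)
    {b : ℕ → ℕ} (hb_pos : ∀ᶠ n in atTop, 1 ≤ b n)
    (hb : (fun n : ℕ => (b n : ℝ)) =o[atTop] fun n : ℕ => (n : ℝ) / Real.log n)
    {α : ℝ} (h0 : 0 ≤ α) (h1 : α < 1) :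
    ∀ᶠ n : ℕ in atTop, ∀ x : Fin n → EuclideanSpace ℝ (Fin D), (∀ i, x i ∈ M) →
      Metric.hausdorffDist (Set.range x) M ≤ coveringScale d A n →
      2 * coveringScale d A n < subsampleRadius α (b n) x := by
  -- This is the bound on the total mass of `b` balls of radius `3t`: such a ball has parameter
  -- `6t`, and `t ^ d = A * (log n / n)`.
  have hsmall : Tendsto (fun n : ℕ => K * 6 ^ d * A * ((b n : ℝ) * (Real.log n / n))) atTop
      (𝓝 0) := by
    simpa using (tendsto_mul_log_div_of_isLittleO hb).const_mul (K * 6 ^ d * A)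
  filter_upwards [(tendsto_coveringScale hd A).eventually_lt_const (by linarith : 0 < t₀ / 6),
    eventually_ge_atTop 2, hb_pos, eventually_le_of_isLittleO_div_log hb,
    hsmall.eventually_lt_const one_pos] with n htr hn hbn hbn' hlt x hx hxM
  have htpos : 0 < coveringScale d A n := coveringScale_pos hA hn
  have htd := coveringScale_pow hd hA.le n
  refine lt_subsampleRadius h0 h1 hbn' x fun s hs => ?_
  refine lt_hausdorffDist_image_range (P := P) (κ := K * (6 * coveringScale d A n) ^ d)
    hM.isBounded hPM hx htpos hxM ?_ (Finset.card_pos.1 (by omega)) ?_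
  · intro y hy
    have := hball (6 * coveringScale d A n) (by linarith) (by linarith) y hy
    rwa [show 6 * coveringScale d A n / 2 = 3 * coveringScale d A n by ring] at this
  · rw [hs, mul_pow, htd]
    linarith

/-- The subsampling radius fails to dominate the Hausdorff error with vanishing probability. -/
theorem tendsto_measureReal_subsampleRadius_lt (hM : IsCompact M) (hPM : P.support = M)
    {t₀ C₁ : ℝ} (ht₀ : 0 < t₀)
    (hdiff : ∀ x ∈ M, ∀ t ∈ Set.Ioo 0 t₀,
      DifferentiableAt ℝ (ballRatio P d x) t ∧ |deriv (ballRatio P d x) t| ≤ C₁)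
    {ρ : ℝ} (hρ : Tendsto (infBallRatio P M d) (𝓝[>] 0) (𝓝 ρ)) (hρ_pos : 0 < ρ)
    (hX_indep : iIndepFun X μ) (hX_law : ∀ i, HasLaw (X i) P μ)
    {b : ℕ → ℕ} (hb_pos : ∀ᶠ n in atTop, 1 ≤ b n)
    (hb : (fun n : ℕ => (b n : ℝ)) =o[atTop] fun n : ℕ => (n : ℝ) / Real.log n)
    {α : ℝ} (h0 : 0 ≤ α) (h1 : α < 1) :
    Tendsto (fun n : ℕ => μ.real {ω | subsampleRadius α (b n) (fun i : Fin n => X i ω) <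
      Metric.hausdorffDist (Set.range fun i : Fin n => X i ω) M}) atTop (𝓝 0) := by
  have hXM := ae_forall_mem_of_support_eq hPM hM.isClosed hX_law
  obtain ⟨r, hr, hlow⟩ := exists_forall_mul_pow_le_measureReal_closedBall hρ hρ_pos
  have hc : 0 < ρ / 2 := half_pos hρ_pos
  -- For `d = 0` the exponent `1 / d` is `0` by convention, so `coveringScale` is constantly `1` and
  -- does not shrink.
  rcases eq_or_ne d 0 with rfl | hd
  · have hlim : Tendsto (fun n : ℕ => 1 / (ρ / 2) * Real.exp (-(n * (ρ / 2)))) atTop (𝓝 0) := by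
      have h := Real.tendsto_exp_neg_atTop_nhds_zero.comp
        (tendsto_natCast_atTop_atTop.atTop_mul_const hc)
      simpa using h.const_mul (1 / (ρ / 2))
    refine tendsto_of_tendsto_of_tendsto_of_le_of_le' tendsto_const_nhds hlim
      (Eventually.of_forall fun _ => measureReal_nonneg) ?_
    filter_upwards [eventually_le_of_isLittleO_div_log hb] with n hbn
    refine (measureReal_mono ?_ (measure_ne_top _ _)).trans
      (measureReal_zero_lt_hausdorffDist_le hX_indep hX_law hXM hc hr
        (by simpa using hlow) n)
    exact fun ω hω => (subsampleRadius_nonneg h0 h1 hbn _).trans_lt hω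
  · obtain ⟨K, -, hup⟩ := exists_forall_measureReal_closedBall_le_mul_pow ht₀ hdiff
    have hP1 : P.real M = 1 := by
      rw [measureReal_def, (mem_ae_iff_prob_eq_one hM.measurableSet).1
      (hPM ▸ Measure.support_mem_ae), ENNReal.toReal_one]
    refine tendsto_of_tendsto_of_tendsto_of_le_of_le' tendsto_const_nhds
      (tendsto_const_div_atTop_nhds_zero_nat (2 ^ d))
      (Eventually.of_forall fun _ => measureReal_nonneg) ?_
    filter_upwards [eventually_measureReal_coveringScale_lt_le hd hX_indep hX_law hXM hc hr hlow,
      eventually_two_mul_coveringScale_lt_subsampleRadius hd hM hP1 ht₀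
        (by positivity : 0 < 2 / (ρ / 2)) hup hb_pos hb h0 h1, eventually_ge_atTop 2]
      with n hcover hrad hn
    refine le_trans ?_ hcover
    refine ENNReal.toReal_mono (measure_ne_top _ _) (measure_mono_ae ?_)
    filter_upwards [hXM] with ω hω hlt
    by_contra hnot
    have hle : Metric.hausdorffDist (Set.range fun i : Fin n => X i ω) M ≤
        coveringScale d (2 / (ρ / 2)) n := not_lt.1 hnot
    have hlt' : subsampleRadius α (b n) (fun i : Fin n => X i ω) <
      Metric.hausdorffDist (Set.range fun i : Fin n => X i ω) M := hlt
    have h3 := hrad _ (fun i : Fin n => hω i) hle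
    have h4 : 0 < coveringScale d (2 / (ρ / 2)) n := coveringScale_pos (by positivity) hn
    linarith

end Coverage

theorem mainTheorem1 {D d : ℕ}
    {Ω : Type*} [MeasurableSpace Ω] (μ : Measure Ω) [IsProbabilityMeasure μ]
    (P : Measure (EuclideanSpace ℝ (Fin D))) [IsProbabilityMeasure P]
    (M : Set (EuclideanSpace ℝ (Fin D))) (hM : IsCompact M) (hPM : P.support = M)
    (t₀ C₁ : ℝ) (ht₀ : 0 < t₀)
    (hdiff : ∀ x ∈ M, ∀ t ∈ Set.Ioo 0 t₀,
      DifferentiableAt ℝ (ballRatio P d x) t ∧ |deriv (ballRatio P d x) t| ≤ C₁)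
    (ρ : ℝ) (hρ : Tendsto (infBallRatio P M d) (𝓝[>] 0) (𝓝 ρ)) (hρ_pos : 0 < ρ)
    (X : ℕ → Ω → EuclideanSpace ℝ (Fin D))
    (hX_indep : iIndepFun X μ) (hX_law : ∀ i, HasLaw (X i) P μ)
    (b : ℕ → ℕ) (hb_pos : ∀ᶠ n in atTop, 1 ≤ b n)
    (hb : (fun n : ℕ => (b n : ℝ)) =o[atTop] fun n : ℕ => (n : ℝ) / Real.log n)
    (α : ℝ) (hα : α ∈ Set.Ioo (0 : ℝ) 1) :
    ∃ C : ℝ, ∀ᶠ n : ℕ in atTop,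
      μ.real {ω | subsampleRadius α (b n) (fun i : Fin n => X i ω) <
          Metric.hausdorffDist (Set.range fun i : Fin n => X i ω) M}
        ≤ α + C * ((b n : ℝ) / n) ^ (1 / 4 : ℝ) := by
  -- No correction term is needed: the probability tends to zero while `α > 0` is fixed.
  refine ⟨0, ?_⟩
  filter_upwards [(tendsto_measureReal_subsampleRadius_lt hM hPM ht₀ hdiff hρ hρ_pos hX_indep
    hX_law hb_pos hb hα.1.le hα.2).eventually_lt_const hα.1] with n hn
  simpa using hn.le
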